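/- Let $X\subset\mathbb R^d$ be a compact convex set, let $\|\cdot\|$ be a norm on $\mathbb R^d$ with dual norm $\|\cdot\|_*$, and let $\psi$ be a differentiable function on $X$ that is $1$-strongly convex with respect to $\|\cdot\|$. Let $D(x,y)=\psi(x)-\psi(y)-\langle\nabla\psi(y),x-y\rangle$ and suppose that $D(x,y)\le\frac12R^2$ for all $x,y\in X$, for some $R<\infty$. Let $\Pi$ be a probability distribution on a measurable space $\Xi$, let $F(\cdot;\xi)$, $\xi\in\Xi$, be finite convex functions on $X$, with $F(x;\cdot)$ measurable and $\Pi$-integrable for each $x\in X$, let $f(x)=\mathbb E_\Pi[F(x;\xi)]$, and let $\mathsf G(x;\xi)\in\partial F(x;\xi)$ be a measurable selection of subgradients. Let $\xi_1,\xi_2,\dots$ be a stochastic process in $\Xi$ with law $P$, let $\mathcal F_s=\sigma(\xi_1,\dots,\xi_s)$, and let $P^t_{[s]}$ be a regular conditional distribution of $\xi_t$ given $\mathcal F_s$. For a distance $d$ between probability distributions and $\epsilon>0$ let $\tau_d(P_{[s]},\epsilon)$ be the smallest integer $n\ge1$ such that $d(P^t_{[s]},\Pi)\le\epsilon$ for all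 $t\ge s+n$ ($\infty$ if there is none). Suppose that the process is uniformly mixing: for $d$ the total variation distance $\int|p-q|\,d\mu$ and for $d$ the Hellinger distance $(\int(\sqrt p-\sqrt q)^2d\mu)^{1/2}$ there are finite deterministic numbers $\tau_d(P,\epsilon)$ such that, with probability $1$, $\tau_d(P_{[s]},\epsilon)\le\tau_d(P,\epsilon)$ for all $\epsilon>0$ and all $s$. Suppose also that there is a constant $L<\infty$ such that, for $\Pi$-almost every $\xi$ and, for each $t\ge1$, for almost every $\xi$ under the law of $\xi_t$, the function $F(\cdot;\xi)$ is $L$-Lipschitz on $X$ with respect to $\|\cdot\|$ and $\|\mathsf G(x;\xi)\|_*\le L$ for all $x\in X$. Let $\alpha>0$ and $\alpha(t)=\alpha/\sqrt t$, let $x(1)\in X$ be arbitrary, and for $t\ge1$ let $$x(t+1)=\operatorname*{argmin}_{x\in X}\Big\{\langle \mathsf G(x(t);\xi_t),x\rangle+\frac1{\alpha(t)}D(x,x(t))\Big\},\qquad \hat x(T)=\frac1T\sum_{t=1}^Tx(t).$$ Let $x^\star$ be a minimizer of $f$ over $X$. Then, as $T\to\infty$, $f(\hat x(T))\to f(x^\star)$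 both in expectation, that is, $f(\hat x(T))$ is integrable for every $T\ge 1$ and $\mathbb E[f(\hat x(T))]\to f(x^\star)$, and with probability $1$. -/

import Mathlib

open MeasureTheory ProbabilityTheory Filter Topology
open scoped NNReal ENNReal

namespace ErgodicMD

noncomputable section

/-! ### Mirror descent -/

section MirrorDescent

variable {E : Type*} [NormedAddCommGroup E] [NormedSpace ℝ E]

/-- `g` is a subgradient at `x` of the function `h`, regarded as a function on the set `X`
(equivalently, a subgradient of `h` plus the convex indicator of `X`). If `h` is the restriction
to `X` of a convex function with a larger domain, then every subgradient of that function at `x`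
is one in this sense. -/
def IsSubgradientOn (X : Set E) (h : E → ℝ) (x : E) (g : StrongDual ℝ E) : Prop :=
  ∀ y ∈ X, h x + g (y - x) ≤ h y

/-- The Bregman divergence `ψ x - ψ y - ⟨∇ψ(y), x - y⟩` of a function `ψ` differentiable on the
convex set `X`. For `x, y ∈ X` the last term is determined by the values of `ψ` on `X`, since
`x - y` is a direction tangent to `X` at `y`. -/
def bregman (X : Set E) (ψ : E → ℝ) (x y : E) : ℝ :=
  ψ x - ψ y - fderivWithin ℝ ψ X y (x - y)

/-- `x` is the sequence of iterates `x 1, x 2, …` of ergodic mirror descent on the samples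
`ξ 1, ξ 2, …`, started from the point `x₁`, with subgradient selection `G` and stepsizes `α`:
`x (t + 1)` minimizes `⟨G (x t) (ξ t), y⟩ + bregman y (x t) / α t` over `y ∈ X`. -/
structure IsEMD {Ω Ξ : Type*} (X : Set E) (ψ : E → ℝ) (G : E → Ξ → StrongDual ℝ E)
    (ξ : ℕ → Ω → Ξ) (α : ℕ → ℝ) (x₁ : E) (x : ℕ → Ω → E) : Prop where
  init : ∀ ω, x 1 ω = x₁
  mem : ∀ t, 1 ≤ t → ∀ ω, x (t + 1) ω ∈ X
  argmin : ∀ t, 1 ≤ t → ∀ ω,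
    IsMinOn (fun y => G (x t ω) (ξ t ω) y + (1 / α t) * bregman X ψ y (x t ω)) X (x (t + 1) ω)

/-- The average `(1 / T) ∑_{t = 1}^T x t`. -/
def average {Ω : Type*} (x : ℕ → Ω → E) (T : ℕ) (ω : Ω) : E :=
  (1 / (T : ℝ)) • ∑ t ∈ Finset.Icc 1 T, x t ω

/-- The objective `f(x) = E_ν[F(x; ·)]`. -/
def objective {Ξ : Type*} [MeasurableSpace Ξ] (F : E → Ξ → ℝ) (ν : Measure Ξ) (x : E) : ℝ :=
  ∫ z, F x z ∂ν

end MirrorDescent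

/-! ### Distances between probability distributions -/

section Distances

variable {Ξ : Type*} [MeasurableSpace Ξ]

/-- Total variation distance `∫ |p - q| dμ`, for the dominating measure `μ = P + Q`. -/
def tvDist (P Q : Measure Ξ) : ℝ :=
  ∫ z, |(P.rnDeriv (P + Q) z).toReal - (Q.rnDeriv (P + Q) z).toReal| ∂(P + Q)

/-- Hellinger distance `(∫ (√p - √q)² dμ)^{1/2}`, for the dominating measure `μ = P + Q`. -/
def hellingerDist (P Q : Measure Ξ) : ℝ :=
  √(∫ z, (√(P.rnDeriv (P + Q) z).toReal - √(Q.rnDeriv (P + Q) z).toReal) ^ 2 ∂(P + Q))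

end Distances

/-! ### Mixing -/

section Mixing

variable {Ω Ξ : Type*} [MeasurableSpace Ω] [MeasurableSpace Ξ]

/-- The σ-field `σ(ξ 1, …, ξ s)` of the first `s` samples. -/
abbrev pastSigma (ξ : ℕ → Ω → Ξ) (s : ℕ) : MeasurableSpace Ω :=
  ⨆ i ∈ Finset.Icc 1 s, MeasurableSpace.comap (ξ i) inferInstance

/-- `κ` is a (regular) conditional distribution of `Y` given the σ-field `m`. -/
structure IsCondLaw (P : Measure Ω) (m : MeasurableSpace Ω) (Y : Ω → Ξ) (κ : Ω → Measure Ξ) :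
    Prop where
  measurable : Measurable[m] κ
  prob : ∀ ω, IsProbabilityMeasure (κ ω)
  condProb : ∀ A, MeasurableSet A → (fun ω => (κ ω).real A) =ᵐ[P] P⟦Y ⁻¹' A | m⟧

/-- For a distance `d`, a target distribution `ν`, and the sequence `ρ t` of distributions of the
samples given the first `s` samples: the number of additional steps required until the
distribution is (and remains) within `ε` of `ν`; it is `⊤` if this never happens. -/
def mixingTime (d : Measure Ξ → Measure Ξ → ℝ) (ν : Measure Ξ) (ρ : ℕ → Measure Ξ) (s : ℕ)
    (ε : ℝ) : ℕ∞ :=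
  sInf {N : ℕ∞ | ∃ n : ℕ, N = n ∧ 1 ≤ n ∧ ∀ t, s + n ≤ t → d (ρ t) ν ≤ ε}

/-- The process `ξ 1, ξ 2, …` is uniformly mixing with limit distribution `ν`: with `κ s t` the
distribution of `ξ t` given the first `s` samples, there are finite (deterministic) uniform mixing
times `τtv ε`, `τhel ε` that almost surely bound the conditional mixing times in total variation
and in Hellinger distance, for all `ε > 0` and all `s`. -/
def UniformlyMixing (P : Measure Ω) (ξ : ℕ → Ω → Ξ) (ν : Measure Ξ) : Prop :=
  ∃ κ : ℕ → ℕ → Ω → Measure Ξ,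
    (∀ s t, s < t → IsCondLaw P (pastSigma ξ s) (ξ t) (κ s t)) ∧
    ∃ τtv τhel : ℝ → ℕ, ∀ᵐ ω ∂P, ∀ ε, 0 < ε → ∀ s,
      mixingTime tvDist ν (fun t => κ s t ω) s ε ≤ τtv ε ∧
      mixingTime hellingerDist ν (fun t => κ s t ω) s ε ≤ τhel ε

end Mixing

end

end ErgodicMD

/-! Strong convexity makes every mirror step small and bounds the regret
`∑ t, (F (x t) (ξ t) - F y (ξ t))` along each sample path; with vanishing stepsizes `α t` such that
`t * α t → ∞` the average regret tends to zero. What remains is to replace the loss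
`F (x t) (ξ t)` by its mean `f (x t)`, although `x t` depends on the samples before `ξ t`. Uniform
mixing decouples them: given the past of `x t`, the sample `ξ (t + k)` has for a suitable lag `k` a
law close to `ν` in total variation, so the conditional mean of the excess loss
`h (x t) (ξ (t + k))`, where `h x z = F x z - F y z`, is close to `f (x t) - f y`. The deviations of
these losses from their conditional means are bounded and orthogonal at index distance at least `k`,
so their averages vanish almost surely. Since steps are small and `h` is Lipschitz in the iterate,
the delay costs nothing in the limit: `h (x t) (ξ (t + k))` may be replaced by
`h (x (t + k)) (ξ (t + k))`. For a minimizer `y` of `f` the average of `f (x t) - f y` therefore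
vanishes, and Jensen's inequality passes to the averaged iterate.
Convergence in expectation follows by dominated convergence, as `f` is bounded on `X`. -/

namespace ErgodicMD

open scoped BigOperators

section Bregman

variable {E : Type*} [NormedAddCommGroup E] [NormedSpace ℝ E] {X : Set E} {ψ : E → ℝ} {m : ℝ}
  {x y : E}

lemma one_div_add_one_mem_Icc (n : ℕ) : 1 / ((n : ℝ) + 1) ∈ Set.Icc (0 : ℝ) 1 :=
  ⟨by positivity, div_le_one_of_le₀ (by simp) (by positivity)⟩

lemma tendsto_slope_fderivWithin (hX : Convex ℝ X) (hψ : DifferentiableOn ℝ ψ X) (hx : x ∈ X)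
    (hy : y ∈ X) :
    Tendsto (fun n : ℕ => ((n : ℝ) + 1) * (ψ (y + (1 / ((n : ℝ) + 1)) • (x - y)) - ψ y)) atTop
      (𝓝 (fderivWithin ℝ ψ X y (x - y))) := by
  refine (hψ y hy).hasFDerivWithinAt.lim (l := atTop) (c := fun n : ℕ => (n : ℝ) + 1)
    (d := fun n : ℕ => (1 / ((n : ℝ) + 1)) • (x - y)) ?_
    (.of_forall fun n => hX.add_smul_sub_mem hy hx (one_div_add_one_mem_Icc n))
    (tendsto_const_nhds.congr fun n => ?_)
  · simpa using (tendsto_one_div_add_atTop_nhds_zero_nat (𝕜 := ℝ)).smul_const (x - y)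
  · rw [smul_smul, mul_one_div_cancel (by positivity), one_smul]

lemma apply_add_smul_sub_sub_le (hψ : StrongConvexOn X m ψ) (hx : x ∈ X) (hy : y ∈ X) {t : ℝ}
    (ht : t ∈ Set.Icc (0 : ℝ) 1) :
    ψ (y + t • (x - y)) - ψ y ≤ t * (ψ x - ψ y - (1 - t) * (m / 2 * ‖x - y‖ ^ 2)) := by
  have h := hψ.2 hx hy ht.1 (sub_nonneg.2 ht.2) (add_sub_cancel t 1)
  have hpoint : t • x + (1 - t) • y = y + t • (x - y) := by module
  simp only [hpoint, smul_eq_mul] at h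
  linarith

lemma half_mul_sq_norm_sub_le_bregman (hψ : DifferentiableOn ℝ ψ X) (hsc : StrongConvexOn X m ψ)
    (hx : x ∈ X) (hy : y ∈ X) : m / 2 * ‖x - y‖ ^ 2 ≤ bregman X ψ x y := by
  have hbound : Tendsto
      (fun n : ℕ => ψ x - ψ y - (1 - 1 / ((n : ℝ) + 1)) * (m / 2 * ‖x - y‖ ^ 2)) atTop
      (𝓝 (ψ x - ψ y - (1 - 0) * (m / 2 * ‖x - y‖ ^ 2))) :=
    tendsto_const_nhds.sub
      ((tendsto_const_nhds.sub tendsto_one_div_add_atTop_nhds_zero_nat).mul_const _)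
  have hderiv := le_of_tendsto_of_tendsto' (tendsto_slope_fderivWithin hsc.1 hψ hx hy) hbound
    fun n => by
      rw [← le_div_iff₀' (by positivity)]
      exact (apply_add_smul_sub_sub_le hsc hx hy (one_div_add_one_mem_Icc n)).trans_eq
        (one_div_mul_eq_div _ _)
  unfold bregman
  linarith

lemma bregman_nonneg (hψ : DifferentiableOn ℝ ψ X) (hsc : StrongConvexOn X m ψ) (hm : 0 ≤ m)
    (hx : x ∈ X) (hy : y ∈ X) : 0 ≤ bregman X ψ x y :=
  (by positivity : (0 : ℝ) ≤ m / 2 * ‖x - y‖ ^ 2).trans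
    (half_mul_sq_norm_sub_le_bregman hψ hsc hx hy)

lemma bregman_self (X : Set E) (ψ : E → ℝ) (x : E) : bregman X ψ x x = 0 := by
  simp [bregman]

lemma isBounded_of_bregman_le (hψ : DifferentiableOn ℝ ψ X) (hsc : StrongConvexOn X m ψ)
    (hm : 0 < m) {B : ℝ} (hB : ∀ x ∈ X, ∀ y ∈ X, bregman X ψ x y ≤ B) :
    Bornology.IsBounded X := by
  refine Metric.isBounded_iff.2 ⟨√(2 * B / m), fun x hx y hy => ?_⟩
  rw [dist_eq_norm]
  refine Real.le_sqrt_of_sq_le ((le_div_iff₀' hm).2 ?_)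
  linarith [half_mul_sq_norm_sub_le_bregman hψ hsc hx hy, hB x hx y hy]

lemma continuous_bregman_left (hψ : ContinuousOn ψ X) (y : E) :
    Continuous fun x : X => bregman X ψ x y := by
  have hψX : Continuous fun x : X => ψ x := hψ.domRestrict
  exact (hψX.sub continuous_const).sub (by fun_prop)

lemma measurable_bregman_right [MeasurableSpace E] [BorelSpace E] (hX : Convex ℝ X)
    (hψ : DifferentiableOn ℝ ψ X) (hx : x ∈ X) : Measurable fun y : X => bregman X ψ x y := by
  have hψX : Continuous (X.domRestrict ψ) := hψ.continuousOn.domRestrict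
  have hderiv : Measurable fun y : X => fderivWithin ℝ ψ X y (x - y) := by
    refine measurable_of_tendsto_metrizable (fun n => ?_)
      (tendsto_pi_nhds.2 fun y => tendsto_slope_fderivWithin hX hψ hx y.2)
    have hpoint : Continuous fun y : X => ψ (y + (1 / ((n : ℝ) + 1)) • (x - y)) :=
      hψX.comp (Continuous.subtype_mk (by fun_prop)
        fun y => hX.add_smul_sub_mem y.2 hx (one_div_add_one_mem_Icc n))
    exact (continuous_const.mul (hpoint.sub hψX)).measurable
  exact (measurable_const.sub hψX.measurable).sub hderiv

end Bregman

section MirrorStep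

variable {E : Type*} [NormedAddCommGroup E] [NormedSpace ℝ E] {X : Set E} {ψ : E → ℝ}
  {g : StrongDual ℝ E} {a m L : ℝ} {u v y : E}

/-- `v` is a mirror descent step on `X` from `u`, for the linear loss `g` and the stepsize `a`. -/
structure IsMirrorStep (X : Set E) (ψ : E → ℝ) (g : StrongDual ℝ E) (a : ℝ) (u v : E) :
    Prop where
  mem : v ∈ X
  isMinOn : IsMinOn (fun y => g y + (1 / a) * bregman X ψ y u) X v

namespace IsMirrorStep

lemma apply_sub_le (h : IsMirrorStep X ψ g a u v) (hX : Convex ℝ X) (hψ : DifferentiableOn ℝ ψ X)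
    (hy : y ∈ X) :
    g (v - y) ≤ (1 / a) * (bregman X ψ y u - bregman X ψ y v - bregman X ψ v u) := by
  have hderiv : HasFDerivWithinAt (fun y => g y + (1 / a) * bregman X ψ y u)
      (g + (1 / a) • (fderivWithin ℝ ψ X v - fderivWithin ℝ ψ X u)) X v := by
    refine g.hasFDerivWithinAt.add (HasFDerivWithinAt.const_mul ?_ (1 / a))
    refine ((hψ v h.mem).hasFDerivWithinAt.sub_const _).sub ?_
    exact (fderivWithin ℝ ψ X u).hasFDerivWithinAt.comp v
      ((hasFDerivWithinAt_id v X).sub_const u) (Set.mapsTo_univ _ _)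
  have hopt := h.isMinOn.localize.hasFDerivWithinAt_nonneg hderiv
    (sub_mem_posTangentConeAt_of_segment_subset (hX.segment_subset h.mem hy))
  simp only [add_apply, smul_apply, sub_apply, smul_eq_mul] at hopt
  unfold bregman
  rw [← sub_add_sub_cancel y v u, ← neg_sub y v, map_neg, map_add]
  linarith

lemma half_mul_sq_norm_sub_le (h : IsMirrorStep X ψ g a u v) (hψ : DifferentiableOn ℝ ψ X)
    (hsc : StrongConvexOn X m ψ) (ha : 0 ≤ a) (hy : y ∈ X) :
    (1 / a) * (m / 2 * ‖y - v‖ ^ 2) ≤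
      (g y + (1 / a) * bregman X ψ y u) - (g v + (1 / a) * bregman X ψ v u) := by
  have hopt := h.apply_sub_le hsc.1 hψ hy
  have hbreg := mul_le_mul_of_nonneg_left
    (half_mul_sq_norm_sub_le_bregman hψ hsc hy h.mem) (one_div_nonneg.2 ha)
  rw [map_sub] at hopt
  linarith

lemma norm_sub_le (h : IsMirrorStep X ψ g a u v) (hψ : DifferentiableOn ℝ ψ X)
    (hsc : StrongConvexOn X m ψ) (hm : 0 < m) (ha : 0 < a) (hg : ‖g‖ ≤ L) (hu : u ∈ X) :
    ‖v - u‖ ≤ a * L / m := by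
  have hL : 0 ≤ L := (norm_nonneg g).trans hg
  have hopt := h.apply_sub_le hsc.1 hψ hu
  have huv := half_mul_sq_norm_sub_le_bregman hψ hsc hu h.mem
  have hvu := half_mul_sq_norm_sub_le_bregman hψ hsc h.mem hu
  have hdual : -(L * ‖v - u‖) ≤ g (v - u) := neg_le_of_abs_le (g.le_of_opNorm_le hg (v - u))
  rw [bregman_self, one_div, ← div_eq_inv_mul, le_div_iff₀' ha] at hopt
  rw [norm_sub_rev] at huv
  have hsq : m * ‖v - u‖ ^ 2 ≤ a * L * ‖v - u‖ := by
    linarith [mul_le_mul_of_nonneg_left hdual ha.le]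
  rw [le_div_iff₀' hm]
  rcases (norm_nonneg (v - u)).eq_or_lt with hzero | hpos
  · rw [← hzero, mul_zero]
    positivity
  · refine le_of_mul_le_mul_right ?_ hpos
    rwa [mul_assoc, ← sq]

lemma regret_le (h : IsMirrorStep X ψ g a u v) (hψ : DifferentiableOn ℝ ψ X)
    (hsc : StrongConvexOn X m ψ) (hm : 0 < m) (ha : 0 < a) (hg : ‖g‖ ≤ L) (hu : u ∈ X)
    (hy : y ∈ X) :
    g (u - y) ≤ (1 / a) * (bregman X ψ y u - bregman X ψ y v) + L ^ 2 / (2 * m) * a := by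
  have hopt := h.apply_sub_le hsc.1 hψ hy
  have hbreg := mul_le_mul_of_nonneg_left
    (half_mul_sq_norm_sub_le_bregman hψ hsc h.mem hu) (one_div_nonneg.2 ha.le)
  have hdual : g (u - v) ≤ L * ‖v - u‖ :=
    norm_sub_rev v u ▸ (le_abs_self _).trans (g.le_of_opNorm_le hg (u - v))
  have hyoung : L * ‖v - u‖ ≤ (1 / a) * (m / 2 * ‖v - u‖ ^ 2) + L ^ 2 / (2 * m) * a := by
    have hsq : 0 ≤ (1 / (2 * a * m)) * (m * ‖v - u‖ - a * L) ^ 2 := by positivity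
    have hexpand : (1 / (2 * a * m)) * (m * ‖v - u‖ - a * L) ^ 2 =
        (1 / a) * (m / 2 * ‖v - u‖ ^ 2) + L ^ 2 / (2 * m) * a - L * ‖v - u‖ := by
      field_simp
      ring
    linarith
  rw [← sub_add_sub_cancel u v y, map_add]
  linarith

end IsMirrorStep

end MirrorStep

section Averages

lemma tendsto_expect_range {u : ℕ → ℝ} {l : ℝ} (hu : Tendsto u atTop (𝓝 l)) :
    Tendsto (fun T => 𝔼 n ∈ Finset.range T, u n) atTop (𝓝 l) := by
  refine hu.cesaro.congr fun T => ?_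
  rw [Finset.expect_eq_sum_div_card, Finset.card_range, inv_mul_eq_div]

lemma sum_range_shift_sub_le {u : ℕ → ℝ} {C : ℝ} (hu : ∀ n, |u n| ≤ C) (s T : ℕ) :
    ∑ n ∈ Finset.range T, (u (n + s) - u n) ≤ 2 * C * s := by
  have htelescope : ∑ n ∈ Finset.range T, (u (n + s) - u n) =
      ∑ n ∈ Finset.range s, (u (T + n) - u n) := by
    have hTs := Finset.sum_range_add u T s
    rw [add_comm T s, Finset.sum_range_add u s T] at hTs
    simp only [Finset.sum_sub_distrib, add_comm _ s]
    linarith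
  rw [htelescope]
  refine (Finset.sum_le_card_nsmul _ _ (2 * C) fun n _ => ?_).trans_eq (by simp [mul_comm])
  linarith [(abs_le.1 (hu (T + n))).2, (abs_le.1 (hu n)).1]

lemma expect_range_shift_sub_le {u : ℕ → ℝ} {C : ℝ} (hu : ∀ n, |u n| ≤ C) (s T : ℕ) :
    𝔼 n ∈ Finset.range T, (u (n + s) - u n) ≤ 2 * C * s / T := by
  rw [Finset.expect_eq_sum_div_card, Finset.card_range]
  exact div_le_div_of_nonneg_right (sum_range_shift_sub_le hu s T) T.cast_nonneg

lemma tendsto_zero_of_forall_le_add_one_div {u : ℕ → ℝ} (hu : ∀ n, 0 ≤ u n)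
    (h : ∀ j : ℕ, ∃ v : ℕ → ℝ, Tendsto v atTop (𝓝 0) ∧ ∀ n, u n ≤ v n + 1 / (j + 1)) :
    Tendsto u atTop (𝓝 0) := by
  refine tendsto_order.2 ⟨fun b hb => .of_forall fun n => hb.trans_le (hu n), fun b hb => ?_⟩
  obtain ⟨j, hj⟩ := exists_nat_one_div_lt hb
  obtain ⟨v, hv, huv⟩ := h j
  filter_upwards [hv.eventually_lt_const (sub_pos.2 hj)] with n hn
  exact (huv n).trans_lt (lt_sub_iff_add_lt.1 hn)

lemma tendsto_expect_range_of_tendsto_sq {u : ℕ → ℝ} {C : ℝ} (hu : ∀ n, |u n| ≤ C) {l : ℝ}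
    (h : Tendsto (fun k => 𝔼 n ∈ Finset.range (k ^ 2), u n) atTop (𝓝 l)) :
    Tendsto (fun T => 𝔼 n ∈ Finset.range T, u n) atTop (𝓝 l) := by
  have hmono : Monotone fun T => ∑ n ∈ Finset.range T, (u n + C) :=
    monotone_nat_of_le_succ fun T => by
      rw [Finset.sum_range_succ]
      linarith [(abs_le.1 (hu T)).1]
  have hmean : ∀ T : ℕ, 0 < T →
      (∑ n ∈ Finset.range T, (u n + C)) / T = (𝔼 n ∈ Finset.range T, u n) + C := fun T hT => by
    rw [Finset.sum_add_distrib, Finset.sum_const, Finset.card_range, nsmul_eq_mul,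
      Finset.expect_eq_sum_div_card, Finset.card_range]
    field_simp
  have hratio : Tendsto (fun n : ℕ => (1 + 1 / (n : ℝ)) ^ 2) atTop (𝓝 ((1 + 0) ^ 2)) :=
    (tendsto_one_div_atTop_nhds_zero_nat.const_add 1).pow 2
  have hlim := tendsto_div_of_monotone_of_exists_subseq_tendsto_div _ (l + C) hmono
    fun a ha => ⟨fun n => n ^ 2, ?_, tendsto_pow_atTop two_ne_zero, ?_⟩
  · refine (hlim.sub_const C).congr' ?_ |>.trans_eq (by rw [add_sub_cancel_right])
    filter_upwards [eventually_gt_atTop 0] with T hT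
    rw [hmean T hT, add_sub_cancel_right]
  · filter_upwards [hratio.eventually_lt_const (by linarith), eventually_gt_atTop 0] with n hn hpos
    have : (0 : ℝ) < n := by exact_mod_cast hpos
    calc (((n + 1) ^ 2 : ℕ) : ℝ) = (1 + 1 / (n : ℝ)) ^ 2 * (n ^ 2 : ℕ) := by
          push_cast
          field_simp
      _ ≤ a * (n ^ 2 : ℕ) := by gcongr
  · refine (h.add_const C).congr' ?_
    filter_upwards [eventually_gt_atTop 0] with n hn
    exact (hmean _ (by positivity)).symm

end Averages

section Regret

/-- Positive stepsizes that decrease to zero, but so slowly that `n * a n` tends to infinity: the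
condition under which the average regret of mirror descent vanishes. -/
structure IsDiminishing (a : ℕ → ℝ) : Prop where
  pos : ∀ n, 0 < a n
  antitone : Antitone a
  tendsto_zero : Tendsto a atTop (𝓝 0)
  tendsto_mul_atTop : Tendsto (fun n : ℕ => n * a n) atTop atTop

lemma isDiminishing_div_sqrt {α : ℝ} (hα : 0 < α) :
    IsDiminishing fun n => α / √((n + 1 : ℕ) : ℝ) := by
  have hsqrt : Tendsto (fun n : ℕ => √((n + 1 : ℕ) : ℝ)) atTop atTop :=
    Real.tendsto_sqrt_atTop.comp (tendsto_natCast_atTop_atTop.comp (tendsto_add_atTop_nat 1))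
  have hzero : Tendsto (fun n : ℕ => α / √((n + 1 : ℕ) : ℝ)) atTop (𝓝 0) := hsqrt.const_div_atTop α
  refine ⟨fun n => by positivity, fun n k hnk => by gcongr, hzero, ?_⟩
  refine ((hsqrt.const_mul_atTop hα).atTop_add hzero.neg).congr fun n => ?_
  rw [← sub_eq_add_neg, mul_div_assoc', eq_div_iff (by positivity), sub_mul,
    div_mul_cancel₀ _ (by positivity), mul_assoc, Real.mul_self_sqrt (by positivity)]
  push_cast
  ring

lemma sum_mul_sub_succ_le {c D : ℕ → ℝ} {B : ℝ} (hc0 : 0 ≤ c 0) (hc : Monotone c)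
    (hD : ∀ n, D n ∈ Set.Icc 0 B) (T : ℕ) :
    ∑ n ∈ Finset.range T, c n * (D n - D (n + 1)) ≤ c T * B := by
  suffices hsum : ∑ n ∈ Finset.range T, c n * (D n - D (n + 1)) ≤ c T * (B - D T) by
    refine hsum.trans (mul_le_mul_of_nonneg_left ?_ (hc0.trans (hc T.zero_le)))
    linarith [(hD T).1]
  induction T with
  | zero => simpa using mul_nonneg hc0 (sub_nonneg.2 (hD 0).2)
  | succ T ih =>
    rw [Finset.sum_range_succ]
    linarith [mul_le_mul_of_nonneg_right (hc T.le_succ) (sub_nonneg.2 (hD (T + 1)).2)]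

variable {E : Type*} [NormedAddCommGroup E] [NormedSpace ℝ E] {X : Set E} {ψ : E → ℝ} {m B L : ℝ}
  {a : ℕ → ℝ} {g : ℕ → StrongDual ℝ E} {x : ℕ → E} {y : E}

lemma sum_regret_le (hψ : DifferentiableOn ℝ ψ X) (hsc : StrongConvexOn X m ψ) (hm : 0 < m)
    (hB : ∀ x ∈ X, ∀ y ∈ X, bregman X ψ x y ≤ B) (ha : ∀ n, 0 < a n) (hanti : Antitone a)
    (hx : ∀ n, x n ∈ X) (hstep : ∀ n, IsMirrorStep X ψ (g n) (a n) (x n) (x (n + 1)))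
    (hg : ∀ n, ‖g n‖ ≤ L) (hy : y ∈ X) (T : ℕ) :
    ∑ n ∈ Finset.range T, g n (x n - y) ≤
      1 / a T * B + L ^ 2 / (2 * m) * ∑ n ∈ Finset.range T, a n := by
  have htelescope := sum_mul_sub_succ_le (c := fun n => 1 / a n)
    (D := fun n => bregman X ψ y (x n)) (one_div_nonneg.2 (ha 0).le)
    (fun i j hij => one_div_le_one_div_of_le (ha j) (hanti hij))
    (fun n => ⟨bregman_nonneg hψ hsc hm.le hy (hx n), hB y hy (x n) (hx n)⟩) T
  rw [Finset.mul_sum]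
  refine (Finset.sum_le_sum fun n _ =>
    (hstep n).regret_le hψ hsc hm (ha n) (hg n) (hx n) hy).trans ?_
  rw [Finset.sum_add_distrib]
  gcongr

lemma expect_regret_le (hψ : DifferentiableOn ℝ ψ X) (hsc : StrongConvexOn X m ψ) (hm : 0 < m)
    (hB : ∀ x ∈ X, ∀ y ∈ X, bregman X ψ x y ≤ B) (ha : ∀ n, 0 < a n) (hanti : Antitone a)
    (hx : ∀ n, x n ∈ X) (hstep : ∀ n, IsMirrorStep X ψ (g n) (a n) (x n) (x (n + 1)))
    (hg : ∀ n, ‖g n‖ ≤ L) (hy : y ∈ X) (T : ℕ) :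
    𝔼 n ∈ Finset.range T, g n (x n - y) ≤
      B / (T * a T) + L ^ 2 / (2 * m) * 𝔼 n ∈ Finset.range T, a n := by
  simp only [Finset.expect_eq_sum_div_card, Finset.card_range]
  calc (∑ n ∈ Finset.range T, g n (x n - y)) / T
      ≤ (1 / a T * B + L ^ 2 / (2 * m) * ∑ n ∈ Finset.range T, a n) / T := by
        gcongr
        exact sum_regret_le hψ hsc hm hB ha hanti hx hstep hg hy T
    _ = B / (T * a T) + L ^ 2 / (2 * m) * ((∑ n ∈ Finset.range T, a n) / T) := by ring

lemma IsDiminishing.tendsto_regret_bound (ha : IsDiminishing a) (B c : ℝ) :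
    Tendsto (fun T : ℕ => B / (T * a T) + c * 𝔼 n ∈ Finset.range T, a n) atTop (𝓝 0) := by
  simpa using (ha.tendsto_mul_atTop.const_div_atTop B).add
    ((tendsto_expect_range ha.tendsto_zero).const_mul c)

end Regret

section LawOfLargeNumbers

variable {Ω : Type*} [MeasurableSpace Ω] {P : Measure Ω} {Z : ℕ → Ω → ℝ} {C : ℝ} {k : ℕ}

lemma ae_tendsto_zero_of_summable_integral_sq (hZ : ∀ n, Integrable (fun ω => Z n ω ^ 2) P)
    (hsum : Summable fun n => ∫ ω, Z n ω ^ 2 ∂P) :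
    ∀ᵐ ω ∂P, Tendsto (fun n => Z n ω) atTop (𝓝 0) := by
  have hnorm : ∑' n, eLpNorm (fun ω => Z n ω ^ 2) 1 P ≠ ∞ := by
    refine (tsum_congr fun n => ?_).trans_ne hsum.tsum_ofReal_ne_top
    rw [eLpNorm_one_eq_lintegral_enorm, ← ofReal_integral_norm_eq_lintegral_enorm (hZ n)]
    simp only [norm_pow, Real.norm_eq_abs, sq_abs]
  filter_upwards [summable_norm_of_tsum_eLpNorm_ne_top le_rfl (fun n => (hZ n).1) hnorm] with ω hω
  have hsqrt := (Real.continuous_sqrt.tendsto 0).comp hω.tendsto_atTop_zero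
  rw [Real.sqrt_zero] at hsqrt
  refine (tendsto_zero_iff_abs_tendsto_zero _).2 (hsqrt.congr fun n => ?_)
  simp [Real.sqrt_sq_eq_abs]

variable [IsProbabilityMeasure P]

lemma integrable_mul_of_bounded (hZ : ∀ n, Measurable (Z n)) (hC : ∀ n ω, |Z n ω| ≤ C)
    (s t : ℕ) : Integrable (fun ω => Z s ω * Z t ω) P :=
  (Integrable.of_bound (hZ t).aestronglyMeasurable C (ae_of_all _ (hC t))).bdd_mul
    (hZ s).aestronglyMeasurable (ae_of_all _ (hC s))

lemma sum_integral_mul_le (hZ : ∀ n, Measurable (Z n)) (hC : ∀ n ω, |Z n ω| ≤ C)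
    (horth : ∀ s t, s + k ≤ t → ∫ ω, Z s ω * Z t ω ∂P = 0) (s T : ℕ) :
    ∑ t ∈ Finset.range T, ∫ ω, Z s ω * Z t ω ∂P ≤ 2 * k * C ^ 2 := by
  have hterm : ∀ t, ∫ ω, Z s ω * Z t ω ∂P ≤ C ^ 2 := fun t => by
    refine (integral_mono (integrable_mul_of_bounded hZ hC s t) (integrable_const (C ^ 2))
      fun ω => ?_).trans_eq (by simp)
    calc Z s ω * Z t ω ≤ |Z s ω| * |Z t ω| := (le_abs_self _).trans_eq (abs_mul _ _)
      _ ≤ C * C := mul_le_mul (hC s ω) (hC t ω) (abs_nonneg _) ((abs_nonneg _).trans (hC s ω))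
      _ = C ^ 2 := (sq C).symm
  have hfar : ∀ t, t ∉ Finset.Ico (s - k) (s + k) → ∫ ω, Z s ω * Z t ω ∂P = 0 := fun t ht => by
    rw [Finset.mem_Ico] at ht
    rcases le_or_gt (s + k) t with h | h
    · exact horth s t h
    · simp_rw [mul_comm (Z s _)]
      exact horth t s (by lia)
  have hcard : (Finset.range T ∩ Finset.Ico (s - k) (s + k)).card ≤ 2 * k :=
    (Finset.card_le_card Finset.inter_subset_right).trans (by rw [Nat.card_Ico]; lia)
  rw [← Finset.sum_subset Finset.inter_subset_left fun t ht htk =>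
    hfar t fun h => htk (Finset.mem_inter.2 ⟨ht, h⟩)]
  refine (Finset.sum_le_card_nsmul _ _ _ fun t _ => hterm t).trans ?_
  rw [nsmul_eq_mul]
  gcongr
  exact_mod_cast hcard

lemma integral_sum_sq_le (hZ : ∀ n, Measurable (Z n)) (hC : ∀ n ω, |Z n ω| ≤ C)
    (horth : ∀ s t, s + k ≤ t → ∫ ω, Z s ω * Z t ω ∂P = 0) (T : ℕ) :
    ∫ ω, (∑ n ∈ Finset.range T, Z n ω) ^ 2 ∂P ≤ T * (2 * k * C ^ 2) := by
  have hint := integrable_mul_of_bounded (P := P) hZ hC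
  simp_rw [sq (∑ n ∈ Finset.range T, Z n _), Finset.sum_mul_sum]
  rw [integral_finsetSum _ fun s _ => integrable_finsetSum _ fun t _ => hint s t]
  simp_rw [integral_finsetSum _ fun t _ => hint _ t]
  refine (Finset.sum_le_card_nsmul _ _ _ fun s _ =>
    sum_integral_mul_le hZ hC horth s T).trans_eq ?_
  simp

lemma integral_expect_sq_le (hZ : ∀ n, Measurable (Z n)) (hC : ∀ n ω, |Z n ω| ≤ C)
    (horth : ∀ s t, s + k ≤ t → ∫ ω, Z s ω * Z t ω ∂P = 0) (T : ℕ) :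
    ∫ ω, (𝔼 n ∈ Finset.range T, Z n ω) ^ 2 ∂P ≤ 2 * k * C ^ 2 * (1 / T) := by
  simp only [Finset.expect_eq_sum_div_card, Finset.card_range, div_pow, integral_div]
  refine (div_le_div_of_nonneg_right (integral_sum_sq_le hZ hC horth T) (by positivity)).trans_eq ?_
  field

lemma abs_expect_range_le {z : ℕ → ℝ} (hz : ∀ n, |z n| ≤ C) (T : ℕ) :
    |𝔼 n ∈ Finset.range T, z n| ≤ C := by
  have hC : 0 ≤ C := (abs_nonneg _).trans (hz 0)
  rcases (Finset.range T).eq_empty_or_nonempty with h | h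
  · simpa [h] using hC
  · exact (Finset.abs_expect_le _ _).trans (Finset.expect_le h fun n _ => hz n)

lemma ae_tendsto_expect_range_of_orthogonal (hZ : ∀ n, Measurable (Z n))
    (hC : ∀ n ω, |Z n ω| ≤ C) (horth : ∀ s t, s + k ≤ t → ∫ ω, Z s ω * Z t ω ∂P = 0) :
    ∀ᵐ ω ∂P, Tendsto (fun T => 𝔼 n ∈ Finset.range T, Z n ω) atTop (𝓝 0) := by
  have hmeas : ∀ T, Measurable fun ω => 𝔼 n ∈ Finset.range T, Z n ω := fun T => by
    simp only [Finset.expect_eq_sum_div_card]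
    exact (Finset.measurable_fun_sum _ fun n _ => hZ n).div_const _
  have hint : ∀ T, Integrable (fun ω => (𝔼 n ∈ Finset.range T, Z n ω) ^ 2) P := fun T => by
    refine Integrable.of_bound ((hmeas T).pow_const 2).aestronglyMeasurable (C ^ 2)
      (ae_of_all _ fun ω => ?_)
    rw [norm_pow]
    exact pow_le_pow_left₀ (norm_nonneg _) (abs_expect_range_le (fun n => hC n ω) T) 2
  -- Along the squares the second moments are of order `1 / r ^ 2`, hence summable.
  have hsq := ae_tendsto_zero_of_summable_integral_sq (fun r => hint (r ^ 2))
    (.of_nonneg_of_le (fun r => integral_nonneg fun ω => sq_nonneg _)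
      (fun r => integral_expect_sq_le hZ hC horth (r ^ 2)) (.mul_left _ ?_))
  · filter_upwards [hsq] with ω hω
    exact tendsto_expect_range_of_tendsto_sq (fun n => hC n ω) hω
  · simpa only [Nat.cast_pow] using Real.summable_one_div_nat_pow.2 one_lt_two

end LawOfLargeNumbers

section Conditioning

variable {Ω Ξ S : Type*} [MeasurableSpace Ξ] {m mΩ : MeasurableSpace Ω} {P : Measure Ω}
  {Y : Ω → Ξ} {κ : Ω → Measure Ξ} {W : Ω → S} {h : S × Ξ → ℝ} {C : ℝ}

lemma IsCondLaw.abs_integral_le (hκ : IsCondLaw P m Y κ) (hC : ∀ p, |h p| ≤ C) (ω : Ω) :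
    |∫ z, h (W ω, z) ∂(κ ω)| ≤ C := by
  have := hκ.prob ω
  simpa using norm_integral_le_of_norm_le_const (μ := κ ω) (f := fun z => h (W ω, z))
    (ae_of_all _ fun z => hC (W ω, z))

variable [MeasurableSpace S]

lemma measurable_integral_of_measurable_law (hκ : Measurable κ)
    (hprob : ∀ ω, IsProbabilityMeasure (κ ω)) (hW : Measurable W) (hh : Measurable h) :
    Measurable fun ω => ∫ z, h (W ω, z) ∂(κ ω) := by
  let K : Kernel Ω Ξ := ⟨κ, hκ⟩
  have : IsMarkovKernel K := ⟨hprob⟩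
  have hjoint : StronglyMeasurable (Function.uncurry fun (ω : Ω) (z : Ξ) => h (W ω, z)) :=
    (hh.comp ((hW.comp measurable_fst).prodMk measurable_snd)).stronglyMeasurable
  exact (StronglyMeasurable.integral_kernel_prod_right (κ := K) hjoint).measurable

namespace IsCondLaw

lemma measurable_integral (hκ : IsCondLaw P m Y κ) (hW : Measurable[m] W) (hh : Measurable h) :
    Measurable[m] fun ω => ∫ z, h (W ω, z) ∂(κ ω) :=
  measurable_integral_of_measurable_law (mΩ := m) hκ.measurable hκ.prob hW hh

variable [IsProbabilityMeasure P]

lemma setLIntegral_apply (hκ : IsCondLaw P m Y κ) (hm : m ≤ mΩ) (hY : Measurable Y) {A : Set Ω}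
    (hA : MeasurableSet[m] A) {t : Set Ξ} (ht : MeasurableSet t) :
    ∫⁻ ω in A, κ ω t ∂P = P (A ∩ Y ⁻¹' t) := by
  have hset : ∫ ω in A, (κ ω).real t ∂P = P.real (A ∩ Y ⁻¹' t) := by
    rw [integral_congr_ae (ae_restrict_of_ae (hκ.condProb t ht)),
      setIntegral_condExp hm ((integrable_const 1).indicator (hY ht)) hA,
      integral_indicator_const _ (hY ht), smul_eq_mul, mul_one,
      measureReal_restrict_apply (hY ht), Set.inter_comm]
  have hκt : Measurable fun ω => κ ω t :=
    (Measure.measurable_coe ht).comp (hκ.measurable.mono hm le_rfl)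
  have hint : Integrable (fun ω => (κ ω).real t) (P.restrict A) :=
    Integrable.of_bound hκt.ennreal_toReal.aestronglyMeasurable 1 <| ae_of_all _ fun ω => by
      have := hκ.prob ω
      rw [Real.norm_of_nonneg measureReal_nonneg]
      exact measureReal_le_one
  rw [← ofReal_measureReal, ← hset,
    ofReal_integral_eq_lintegral_ofReal hint (ae_of_all _ fun _ => measureReal_nonneg)]
  refine lintegral_congr fun ω => ?_
  have := hκ.prob ω
  exact (ofReal_measureReal (μ := κ ω)).symm

lemma map_prodMk_eq (hκ : IsCondLaw P m Y κ) (hm : m ≤ mΩ) (hY : Measurable Y)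
    (hW : Measurable[m] W) (K : Kernel Ω Ξ) [IsMarkovKernel K] (hK : ∀ ω, K ω = κ ω) :
    P.map (fun ω => (W ω, Y ω)) = (P ⊗ₘ K).map (Prod.map W id) := by
  have hW' : Measurable W := hW.mono hm le_rfl
  have := Measure.isProbabilityMeasure_map (μ := P) (hW'.prodMk hY).aemeasurable
  refine Measure.ext_prod fun {s t} hs ht => ?_
  have hrect : (Prod.map W (id : Ξ → Ξ)) ⁻¹' (s ×ˢ t) = (W ⁻¹' s) ×ˢ t := rfl
  rw [Measure.map_apply (hW'.prodMk hY) (hs.prod ht),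
    Measure.map_apply (hW'.prodMap measurable_id) (hs.prod ht), hrect,
    Measure.compProd_apply_prod (hW' hs) ht, Set.mk_preimage_prod]
  simp only [hK, hκ.setLIntegral_apply hm hY (hW hs) ht]

lemma integral_comp (hκ : IsCondLaw P m Y κ) (hm : m ≤ mΩ) (hY : Measurable Y)
    (hW : Measurable[m] W) (hh : Measurable h) (hC : ∀ ω z, |h (W ω, z)| ≤ C) :
    ∫ ω, h (W ω, Y ω) ∂P = ∫ ω, ∫ z, h (W ω, z) ∂(κ ω) ∂P := by
  have hW' : Measurable W := hW.mono hm le_rfl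
  let K : Kernel Ω Ξ := ⟨κ, hκ.measurable.mono hm le_rfl⟩
  have : IsMarkovKernel K := ⟨hκ.prob⟩
  have hint : Integrable (fun p : Ω × Ξ => h (Prod.map W id p)) (P ⊗ₘ K) :=
    Integrable.of_bound (hh.comp (hW'.prodMap measurable_id)).aestronglyMeasurable C
      (ae_of_all _ fun p => hC p.1 p.2)
  rw [← integral_map (f := h) (hW'.prodMk hY).aemeasurable hh.aestronglyMeasurable,
    hκ.map_prodMk_eq hm hY hW K fun _ => rfl,
    integral_map (hW'.prodMap measurable_id).aemeasurable hh.aestronglyMeasurable,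
    Measure.integral_compProd hint]
  rfl

lemma integral_mul_sub_eq_zero (hκ : IsCondLaw P m Y κ) (hm : m ≤ mΩ) (hY : Measurable Y)
    (hW : Measurable[m] W) (hh : Measurable h) (hC : ∀ p, |h p| ≤ C) {V : Ω → ℝ}
    (hV : Measurable[m] V) {D : ℝ} (hD : ∀ ω, |V ω| ≤ D) :
    ∫ ω, V ω * (h (W ω, Y ω) - ∫ z, h (W ω, z) ∂(κ ω)) ∂P = 0 := by
  have hV' : AEStronglyMeasurable V P := (hV.mono hm le_rfl).aestronglyMeasurable
  have hsample : Integrable (fun ω => h (W ω, Y ω)) P :=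
    Integrable.of_bound (hh.comp ((hW.mono hm le_rfl).prodMk hY)).aestronglyMeasurable C
      (ae_of_all _ fun ω => hC _)
  have hmean : Integrable (fun ω => ∫ z, h (W ω, z) ∂(κ ω)) P :=
    Integrable.of_bound ((hκ.measurable_integral hW hh).mono hm le_rfl).aestronglyMeasurable C
      (ae_of_all _ (hκ.abs_integral_le hC))
  have hcond := hκ.integral_comp hm hY (W := fun ω => (V ω, W ω)) (hV.prodMk hW)
    (h := fun p => p.1.1 * h (p.1.2, p.2)) (by fun_prop) (C := D * C) fun ω z => by
      rw [abs_mul]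
      exact mul_le_mul (hD ω) (hC _) (abs_nonneg _) ((abs_nonneg _).trans (hD ω))
  simp_rw [integral_const_mul] at hcond
  simp_rw [mul_sub]
  rw [integral_sub (hsample.bdd_mul hV' (ae_of_all _ hD)) (hmean.bdd_mul hV' (ae_of_all _ hD)),
    hcond, sub_self]

end IsCondLaw

end Conditioning

section Mixing

variable {Ω Ξ : Type*} [MeasurableSpace Ξ]

lemma abs_integral_sub_le_mul_tvDist (p q : Measure Ξ) [IsFiniteMeasure p] [IsFiniteMeasure q]
    {h : Ξ → ℝ} (hh : Measurable h) {C : ℝ} (hC : ∀ z, |h z| ≤ C) :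
    |∫ z, h z ∂p - ∫ z, h z ∂q| ≤ C * tvDist p q := by
  have hp : p ≪ p + q := Measure.AbsolutelyContinuous.rfl.add_right q
  have hq : q ≪ p + q := add_comm q p ▸ Measure.AbsolutelyContinuous.rfl.add_right p
  have hpint : Integrable (fun z => (p.rnDeriv (p + q) z).toReal) (p + q) :=
    Measure.integrable_toReal_rnDeriv
  have hqint : Integrable (fun z => (q.rnDeriv (p + q) z).toReal) (p + q) :=
    Measure.integrable_toReal_rnDeriv
  have hpsmul : Integrable (fun z => (p.rnDeriv (p + q) z).toReal • h z) (p + q) :=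
    hpint.mul_bdd hh.aestronglyMeasurable (ae_of_all _ hC)
  have hqsmul : Integrable (fun z => (q.rnDeriv (p + q) z).toReal • h z) (p + q) :=
    hqint.mul_bdd hh.aestronglyMeasurable (ae_of_all _ hC)
  rw [← integral_rnDeriv_smul hp, ← integral_rnDeriv_smul hq, ← integral_sub hpsmul hqsmul,
    tvDist, ← integral_const_mul]
  rw [← Real.norm_eq_abs]
  refine norm_integral_le_of_norm_le ((hpint.sub hqint).abs.const_mul C) (ae_of_all _ fun z => ?_)
  rw [← sub_smul, norm_smul, mul_comm]
  exact mul_le_mul_of_nonneg_right (hC z) (norm_nonneg _)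

lemma dist_le_of_mixingTime_le {d : Measure Ξ → Measure Ξ → ℝ} {ν : Measure Ξ}
    {ρ : ℕ → Measure Ξ} {s n : ℕ} {ε : ℝ} (h : mixingTime d ν ρ s ε ≤ n) {t : ℕ}
    (ht : s + n ≤ t) : d (ρ t) ν ≤ ε := by
  have hne : {N : ℕ∞ | ∃ n : ℕ, N = n ∧ 1 ≤ n ∧ ∀ t, s + n ≤ t → d (ρ t) ν ≤ ε}.Nonempty := by
    by_contra hempty
    rw [mixingTime, Set.not_nonempty_iff_eq_empty.1 hempty, sInf_empty] at h
    exact absurd h (not_le.2 (ENat.natCast_lt_top n))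
  obtain ⟨k, hk, -, hkt⟩ := csInf_mem hne
  rw [mixingTime, hk, Nat.cast_le] at h
  exact hkt t (by lia)

/-- The process `ξ 1, ξ 2, …` is uniformly mixing in total variation with limit `ν`: for every
`ε > 0` there is a lag `k` such that, whatever the past, the sample `k` steps ahead almost surely
has a conditional distribution within `ε` of `ν`. -/
def IsTVMixing [MeasurableSpace Ω] (P : Measure Ω) (ξ : ℕ → Ω → Ξ) (ν : Measure Ξ) : Prop :=
  ∀ ε > 0, ∃ k ≥ 1, ∃ κ : ℕ → Ω → Measure Ξ, ∀ s,
    IsCondLaw P (pastSigma ξ s) (ξ (s + k)) (κ s) ∧ ∀ᵐ ω ∂P, tvDist (κ s ω) ν ≤ ε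

lemma UniformlyMixing.isTVMixing [MeasurableSpace Ω] {P : Measure Ω} {ξ : ℕ → Ω → Ξ}
    {ν : Measure Ξ} (h : UniformlyMixing P ξ ν) : IsTVMixing P ξ ν := by
  obtain ⟨κ, hκ, τ, _, hτ⟩ := h
  refine fun ε hε => ⟨τ ε + 1, by simp, fun s => κ s (s + (τ ε + 1)), fun s =>
    ⟨hκ s _ (by lia), ?_⟩⟩
  filter_upwards [hτ] with ω hω
  exact dist_le_of_mixingTime_le (ρ := fun t => κ s t ω) (hω ε hε s).1 (by lia)

lemma pastSigma_le [mΩ : MeasurableSpace Ω] {ξ : ℕ → Ω → Ξ} (hξ : ∀ t, 1 ≤ t → Measurable (ξ t))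
    (s : ℕ) : pastSigma ξ s ≤ mΩ :=
  iSup₂_le fun i hi => (hξ i (Finset.mem_Icc.1 hi).1).comap_le

lemma pastSigma_mono (ξ : ℕ → Ω → Ξ) {s t : ℕ} (h : s ≤ t) : pastSigma ξ s ≤ pastSigma ξ t :=
  biSup_mono fun _ hi => Finset.Icc_subset_Icc le_rfl h hi

lemma measurable_pastSigma (ξ : ℕ → Ω → Ξ) {i s : ℕ} (hi : 1 ≤ i) (his : i ≤ s) :
    Measurable[pastSigma ξ s] (ξ i) :=
  (comap_measurable (ξ i)).mono
    (le_iSup₂_of_le (f := fun i (_ : i ∈ Finset.Icc 1 s) =>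
      MeasurableSpace.comap (ξ i) inferInstance) i (Finset.mem_Icc.2 ⟨hi, his⟩) le_rfl) le_rfl

end Mixing

section PredictableAverages

variable {Ω Ξ S : Type*} [MeasurableSpace Ω] [MeasurableSpace Ξ] [MeasurableSpace S]
  {P : Measure Ω} [IsProbabilityMeasure P] {ξ : ℕ → Ω → Ξ} {W : ℕ → Ω → S} {h : S × Ξ → ℝ} {C : ℝ}

lemma ae_tendsto_expect_sub_condMean (hξ : ∀ t, 1 ≤ t → Measurable (ξ t)) {k : ℕ} (hk : 1 ≤ k)
    {κ : ℕ → Ω → Measure Ξ} (hκ : ∀ n, IsCondLaw P (pastSigma ξ n) (ξ (n + k)) (κ n))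
    (hW : ∀ n, Measurable[pastSigma ξ n] (W n)) (hh : Measurable h) (hC : ∀ p, |h p| ≤ C) :
    ∀ᵐ ω ∂P, Tendsto (fun T => 𝔼 n ∈ Finset.range T,
      (h (W n ω, ξ (n + k) ω) - ∫ z, h (W n ω, z) ∂(κ n ω))) atTop (𝓝 0) := by
  have hmeas : ∀ n, Measurable[pastSigma ξ (n + k)] fun ω =>
      h (W n ω, ξ (n + k) ω) - ∫ z, h (W n ω, z) ∂(κ n ω) := fun n => by
    have hle := pastSigma_mono ξ (Nat.le_add_right n k)
    exact Measurable.sub (hh.comp (((hW n).mono hle le_rfl).prodMk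
      (measurable_pastSigma ξ (by lia) le_rfl))) (((hκ n).measurable_integral (hW n) hh).mono
        hle le_rfl)
  have hbound : ∀ n ω, |h (W n ω, ξ (n + k) ω) - ∫ z, h (W n ω, z) ∂(κ n ω)| ≤ C + C :=
    fun n ω => (abs_sub _ _).trans (add_le_add (hC _) ((hκ n).abs_integral_le hC ω))
  exact ae_tendsto_expect_range_of_orthogonal (k := k)
    (fun n => (hmeas n).mono (pastSigma_le hξ _) le_rfl) hbound fun s t hst =>
      (hκ t).integral_mul_sub_eq_zero (pastSigma_le hξ t) (hξ (t + k) (by lia)) (hW t) hh hC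
        ((hmeas s).mono (pastSigma_mono ξ hst) le_rfl) (hbound s)

end PredictableAverages

section OnlineToBatch

lemma tendsto_dist_add {S : Type*} [PseudoMetricSpace S] {w : ℕ → S}
    (hw : Tendsto (fun n => dist (w (n + 1)) (w n)) atTop (𝓝 0)) (s : ℕ) :
    Tendsto (fun n => dist (w (n + s)) (w n)) atTop (𝓝 0) := by
  induction s with
  | zero => simp
  | succ s ih =>
    refine squeeze_zero (fun n => dist_nonneg) (fun n => dist_triangle _ (w (n + s)) _) ?_
    simpa only [Function.comp_def, add_assoc, add_zero] using
      (hw.comp (tendsto_add_atTop_nat s)).add ih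

lemma exists_tendsto_expect_range_le {a l e : ℕ → ℝ} {C ε : ℝ} {s : ℕ} (hl : ∀ n, |l n| ≤ C)
    (he : Tendsto (fun T => 𝔼 n ∈ Finset.range T, e n) atTop (𝓝 0)) (hε : 0 ≤ ε)
    (h : ∀ n, a n ≤ l (n + s) + e n + ε) :
    ∃ v : ℕ → ℝ, Tendsto v atTop (𝓝 0) ∧ ∀ T,
      𝔼 n ∈ Finset.range T, a n ≤ 𝔼 n ∈ Finset.range T, l n + v T + ε := by
  refine ⟨fun T => 2 * C * s / T + 𝔼 n ∈ Finset.range T, e n, ?_, fun T => ?_⟩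
  · simpa using (tendsto_const_div_atTop_nhds_zero_nat (2 * C * s)).add he
  · have hconst : 𝔼 _n ∈ Finset.range T, ε ≤ ε :=
      (le_abs_self _).trans (abs_expect_range_le (fun _ => (abs_of_nonneg hε).le) T)
    have hshift := expect_range_shift_sub_le hl s T
    have havg := Finset.expect_le_expect (s := Finset.range T) fun n _ => h n
    simp only [Finset.expect_add_distrib, Finset.expect_sub_distrib] at havg hshift
    linarith

variable {Ω Ξ S : Type*} [MeasurableSpace Ω] [MeasurableSpace Ξ] [MeasurableSpace S]
  [PseudoMetricSpace S] {P : Measure Ω} [IsProbabilityMeasure P] {ν : Measure Ξ}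
  [IsFiniteMeasure ν] {ξ : ℕ → Ω → Ξ} {W : ℕ → Ω → S} {h : S × Ξ → ℝ} {C K : ℝ}

lemma ae_exists_expect_integral_le (hξ : ∀ t, 1 ≤ t → Measurable (ξ t)) (hmix : IsTVMixing P ξ ν)
    (hW : ∀ n, Measurable[pastSigma ξ n] (W n))
    (hslow : ∀ᵐ ω ∂P, Tendsto (fun n => dist (W (n + 1) ω) (W n ω)) atTop (𝓝 0))
    (hh : Measurable h) (hC : ∀ p, |h p| ≤ C)
    (hK : ∀ w w' z, |h (w, z) - h (w', z)| ≤ K * dist w w') {ε : ℝ} (hε : 0 < ε) :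
    ∀ᵐ ω ∂P, ∃ v : ℕ → ℝ, Tendsto v atTop (𝓝 0) ∧ ∀ T,
      𝔼 n ∈ Finset.range T, ∫ z, h (W n ω, z) ∂ν ≤
        𝔼 n ∈ Finset.range T, h (W n ω, ξ (n + 1) ω) + v T + ε := by
  obtain ⟨δ, hδ, hδε⟩ := exists_pos_mul_lt hε C
  obtain ⟨k, hk, κ, hκ⟩ := hmix δ hδ
  obtain ⟨s, rfl⟩ := Nat.exists_eq_add_of_le' hk
  filter_upwards [hslow, ae_all_iff.2 fun n => (hκ n).2,
    ae_tendsto_expect_sub_condMean hξ hk (fun n => (hκ n).1) hW hh hC] with ω hslowω htv hcentred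
  set centred : ℕ → ℝ := fun n =>
    h (W n ω, ξ (n + (s + 1)) ω) - ∫ z, h (W n ω, z) ∂(κ n ω)
  have herror : Tendsto (fun T => 𝔼 n ∈ Finset.range T,
      (K * dist (W (n + s) ω) (W n ω) - centred n)) atTop (𝓝 0) := by
    simp only [Finset.expect_sub_distrib, ← Finset.mul_expect]
    simpa using ((tendsto_expect_range
      (tendsto_dist_add (w := fun n => W n ω) hslowω s)).const_mul K).sub hcentred
  have hloss : ∀ n, |h (W n ω, ξ (n + 1) ω)| ≤ C := fun n => hC _
  refine exists_tendsto_expect_range_le (s := s) hloss herror hε.le fun n => ?_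
  have := (hκ n).1.prob ω
  have hdist := abs_le.1 (abs_integral_sub_le_mul_tvDist (κ n ω) ν
    (hh.comp measurable_prodMk_left) fun z => hC (W n ω, z))
  have hlip := abs_le.1 (hK (W (n + s) ω) (W n ω) (ξ (n + s + 1) ω))
  have hclose := mul_le_mul_of_nonneg_left (htv n) ((abs_nonneg _).trans (hC (W n ω, ξ n ω)))
  simp only [centred, Function.comp_apply, ← add_assoc] at hdist ⊢
  linarith

lemma ae_tendsto_expect_integral_of_regret_le (hξ : ∀ t, 1 ≤ t → Measurable (ξ t))
    (hmix : IsTVMixing P ξ ν) (hW : ∀ n, Measurable[pastSigma ξ n] (W n))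
    (hslow : ∀ᵐ ω ∂P, Tendsto (fun n => dist (W (n + 1) ω) (W n ω)) atTop (𝓝 0))
    (hh : Measurable h) (hC : ∀ p, |h p| ≤ C)
    (hK : ∀ w w' z, |h (w, z) - h (w', z)| ≤ K * dist w w')
    (hnonneg : ∀ w, 0 ≤ ∫ z, h (w, z) ∂ν) {q : ℕ → ℝ} (hq : Tendsto q atTop (𝓝 0))
    (hregret : ∀ᵐ ω ∂P, ∀ T, 𝔼 n ∈ Finset.range T, h (W n ω, ξ (n + 1) ω) ≤ q T) :
    ∀ᵐ ω ∂P, Tendsto (fun T => 𝔼 n ∈ Finset.range T, ∫ z, h (W n ω, z) ∂ν) atTop (𝓝 0) := by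
  have hloss := ae_all_iff.2 fun j : ℕ => ae_exists_expect_integral_le hξ hmix hW hslow hh hC hK
    (Nat.one_div_pos_of_nat (n := j))
  filter_upwards [hloss, hregret] with ω hω hregretω
  refine tendsto_zero_of_forall_le_add_one_div
    (fun T => Finset.expect_nonneg fun n _ => hnonneg _) fun j => ?_
  obtain ⟨v, hv, hle⟩ := hω j
  exact ⟨fun T => q T + v T, by simpa using hq.add hv, fun T =>
    (hle T).trans (by linarith [hregretω T])⟩

end OnlineToBatch

section IterateMeasurability

variable {Ω S : Type*} [MeasurableSpace Ω] [PseudoMetricSpace S] [TopologicalSpace.SeparableSpace S]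
  [MeasurableSpace S] {φ : Ω → S → ℝ}

lemma exists_measurable_approx_minimizer [Nonempty S] (hcont : ∀ ω, Continuous (φ ω))
    (hmeas : ∀ y, Measurable fun ω => φ ω y) (hbdd : ∀ ω, BddBelow (Set.range (φ ω))) {ε : ℝ}
    (hε : 0 < ε) : ∃ w : Ω → S, Measurable w ∧ ∀ ω y, φ ω (w ω) ≤ φ ω y + ε := by
  classical
  let D := TopologicalSpace.denseSeq S
  have hD : DenseRange D := TopologicalSpace.denseRange_denseSeq S
  have hexists : ∀ ω, ∃ n, ∀ j, φ ω (D n) ≤ φ ω (D j) + ε := fun ω => by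
    obtain ⟨y, hy⟩ := exists_lt_of_ciInf_lt (lt_add_of_pos_right (⨅ y, φ ω y) hε)
    obtain ⟨n, hn⟩ := hD.exists_mem_open (isOpen_Iio.preimage (hcont ω)) ⟨y, hy⟩
    exact ⟨n, fun j => hn.le.trans (add_le_add_left (ciInf_le (hbdd ω) (D j)) ε)⟩
  have hfind : Measurable fun ω => Nat.find (hexists ω) := measurable_find hexists fun n => by
    simp only [Set.ofPred_forall]
    exact MeasurableSet.iInter fun j =>
      measurableSet_le (hmeas (D n)) ((hmeas (D j)).add_const ε)
  refine ⟨fun ω => D (Nat.find (hexists ω)), measurable_from_nat.comp hfind, fun ω y => ?_⟩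
  exact hD.induction_on y (isClosed_le continuous_const ((hcont ω).add continuous_const))
    (Nat.find_spec (hexists ω))

lemma measurable_of_mul_sq_dist_le [BorelSpace S] (hcont : ∀ ω, Continuous (φ ω))
    (hmeas : ∀ y, Measurable fun ω => φ ω y) {v : Ω → S} {c : ℝ} (hc : 0 < c)
    (hgrowth : ∀ ω y, c * dist y (v ω) ^ 2 ≤ φ ω y - φ ω (v ω)) : Measurable v := by
  rcases isEmpty_or_nonempty Ω with hΩ | ⟨⟨ω₀⟩⟩
  · exact measurable_of_empty v
  have : Nonempty S := ⟨v ω₀⟩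
  have hbdd : ∀ ω, BddBelow (Set.range (φ ω)) := fun ω => ⟨φ ω (v ω), by
    rintro _ ⟨y, rfl⟩
    exact sub_nonneg.1 ((by positivity : 0 ≤ c * dist y (v ω) ^ 2).trans (hgrowth ω y))⟩
  choose w hw hwmin using fun k : ℕ => exists_measurable_approx_minimizer hcont hmeas hbdd
    (Nat.one_div_pos_of_nat (n := k) (α := ℝ))
  refine measurable_of_tendsto_metrizable hw (tendsto_pi_nhds.2 fun ω => ?_)
  rw [tendsto_iff_dist_tendsto_zero]
  have hdist : ∀ k, dist (w k ω) (v ω) ≤ √(1 / ((k : ℝ) + 1) / c) := fun k => by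
    refine Real.le_sqrt_of_sq_le ((le_div_iff₀' hc).2 ?_)
    linarith [hgrowth ω (w k ω), hwmin k ω (v ω)]
  refine squeeze_zero (fun k => dist_nonneg) hdist ?_
  simpa using ((tendsto_one_div_add_atTop_nhds_zero_nat (𝕜 := ℝ)).div_const c).sqrt

end IterateMeasurability

section Iterates

variable {E : Type*} [NormedAddCommGroup E] [NormedSpace ℝ E] {X : Set E} {ψ : E → ℝ} {m : ℝ}

lemma measurable_of_isMirrorStep [SecondCountableTopology E] [MeasurableSpace E] [BorelSpace E]
    {Ω : Type*} [MeasurableSpace Ω] (hψ : DifferentiableOn ℝ ψ X) (hsc : StrongConvexOn X m ψ)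
    (hm : 0 < m) {a : ℝ} (ha : 0 < a) {u v : Ω → X} (hu : Measurable u) {g : Ω → StrongDual ℝ E}
    (hg : ∀ y, Measurable fun ω => g ω y)
    (hstep : ∀ ω, IsMirrorStep X ψ (g ω) a (u ω) (v ω)) : Measurable v := by
  refine measurable_of_mul_sq_dist_le
    (φ := fun ω (y : X) => g ω y + (1 / a) * bregman X ψ y (u ω)) (c := 1 / a * (m / 2))
    (fun ω => ?_) (fun y => ?_) (by positivity) fun ω y => ?_
  · exact ((g ω).continuous.comp continuous_subtype_val).add
      (continuous_const.mul (continuous_bregman_left hψ.continuousOn (u ω)))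
  · exact (hg y).add (((measurable_bregman_right hsc.1 hψ y.2).comp hu).const_mul _)
  · rw [Subtype.dist_eq, dist_eq_norm, mul_assoc]
    exact (hstep ω).half_mul_sq_norm_sub_le hψ hsc ha.le y.2

namespace IsEMD

variable {Ω Ξ : Type*} {G : E → Ξ → StrongDual ℝ E} {ξ : ℕ → Ω → Ξ} {α : ℕ → ℝ} {x₁ : E}
  {x : ℕ → Ω → E} {ω : Ω} {L : ℝ}

lemma mem_succ (hx : IsEMD X ψ G ξ α x₁ x) (hx₁ : x₁ ∈ X) (n : ℕ) (ω : Ω) : x (n + 1) ω ∈ X := by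
  cases n with
  | zero => rwa [hx.init]
  | succ n => exact hx.mem (n + 1) (by lia) ω

lemma isMirrorStep (hx : IsEMD X ψ G ξ α x₁ x) (n : ℕ) (ω : Ω) :
    IsMirrorStep X ψ (G (x (n + 1) ω) (ξ (n + 1) ω)) (α (n + 1)) (x (n + 1) ω)
      (x (n + 1 + 1) ω) :=
  ⟨hx.mem (n + 1) (by lia) ω, hx.argmin (n + 1) (by lia) ω⟩

/-- The iterates as points of the domain, renumbered from `0` so that the `n`-th one is determined
by the first `n` samples. -/
def iterate (hx : IsEMD X ψ G ξ α x₁ x) (hx₁ : x₁ ∈ X) (n : ℕ) (ω : Ω) : X :=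
  ⟨x (n + 1) ω, hx.mem_succ hx₁ n ω⟩

lemma measurable_iterate [SecondCountableTopology E] [MeasurableSpace E] [BorelSpace E]
    [MeasurableSpace Ξ] (hx : IsEMD X ψ G ξ α x₁ x) (hx₁ : x₁ ∈ X) (hψ : DifferentiableOn ℝ ψ X)
    (hsc : StrongConvexOn X m ψ) (hm : 0 < m) (hα : ∀ n, 0 < α (n + 1))
    (hG : ∀ y, Measurable fun p : X × Ξ => G p.1 p.2 y) (n : ℕ) :
    Measurable[pastSigma ξ n] (hx.iterate hx₁ n) := by
  induction n with
  | zero =>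
    have hconst : hx.iterate hx₁ 0 = fun _ => ⟨x₁, hx₁⟩ := funext fun ω => Subtype.ext (hx.init ω)
    rw [hconst]
    exact measurable_const
  | succ n ih =>
    let _ : MeasurableSpace Ω := pastSigma ξ (n + 1)
    have hu : Measurable (hx.iterate hx₁ n) := ih.mono (pastSigma_mono ξ n.le_succ) le_rfl
    exact measurable_of_isMirrorStep hψ hsc hm (hα n) hu
      (fun y => (hG y).comp (hu.prodMk (measurable_pastSigma ξ (by lia) le_rfl)))
      fun ω => hx.isMirrorStep n ω

lemma tendsto_dist_iterate (hx : IsEMD X ψ G ξ α x₁ x) (hx₁ : x₁ ∈ X)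
    (hψ : DifferentiableOn ℝ ψ X) (hsc : StrongConvexOn X m ψ) (hm : 0 < m)
    (hα : IsDiminishing fun n => α (n + 1)) (hG : ∀ n, ∀ y ∈ X, ‖G y (ξ (n + 1) ω)‖ ≤ L) :
    Tendsto (fun n => dist (hx.iterate hx₁ (n + 1) ω) (hx.iterate hx₁ n ω)) atTop (𝓝 0) := by
  refine squeeze_zero (g := fun n => α (n + 1) * L / m) (fun n => dist_nonneg) (fun n => ?_) ?_
  · rw [Subtype.dist_eq, dist_eq_norm]
    exact (hx.isMirrorStep n ω).norm_sub_le hψ hsc hm (hα.pos n) (hG n _ (hx.mem_succ hx₁ n ω))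
      (hx.mem_succ hx₁ n ω)
  · simpa using (hα.tendsto_zero.mul_const L).div_const m

lemma expect_loss_sub_le (hx : IsEMD X ψ G ξ α x₁ x) (hx₁ : x₁ ∈ X)
    (hψ : DifferentiableOn ℝ ψ X) (hsc : StrongConvexOn X m ψ) (hm : 0 < m) {B : ℝ}
    (hB : ∀ x ∈ X, ∀ y ∈ X, bregman X ψ x y ≤ B) (hα : IsDiminishing fun n => α (n + 1))
    {F : E → Ξ → ℝ} (hsub : ∀ z, ∀ x ∈ X, IsSubgradientOn X (fun y => F y z) x (G x z))
    (hG : ∀ n, ∀ y ∈ X, ‖G y (ξ (n + 1) ω)‖ ≤ L) {y : E} (hy : y ∈ X) (T : ℕ) :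
    𝔼 n ∈ Finset.range T, (F (x (n + 1) ω) (ξ (n + 1) ω) - F y (ξ (n + 1) ω)) ≤
      B / (T * α (T + 1)) + L ^ 2 / (2 * m) * 𝔼 n ∈ Finset.range T, α (n + 1) := by
  have hmem : ∀ n, x (n + 1) ω ∈ X := fun n => hx.mem_succ hx₁ n ω
  refine (Finset.expect_le_expect fun n _ => ?_).trans (expect_regret_le hψ hsc hm hB hα.pos
    hα.antitone hmem (fun n => hx.isMirrorStep n ω) (fun n => hG n _ (hmem n)) hy T)
  have hsubgradient := hsub (ξ (n + 1) ω) _ (hmem n) y hy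
  rw [← neg_sub, map_neg] at hsubgradient
  linarith

end IsEMD

end Iterates

section ExcessLoss

variable {E : Type*} [NormedAddCommGroup E] [NormedSpace ℝ E] {X : Set E} {f : E → ℝ}
  {g : E → StrongDual ℝ E} {L : ℝ≥0}

lemma convexOn_of_isSubgradientOn (hX : Convex ℝ X)
    (hsub : ∀ x ∈ X, IsSubgradientOn X f x (g x)) : ConvexOn ℝ X f := by
  refine ⟨hX, fun x hx y hy a b ha hb hab => ?_⟩
  set z := a • x + b • y
  have hz : z ∈ X := hX hx hy ha hb hab
  have hcancel : a * g z (x - z) + b * g z (y - z) = 0 := by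
    have hzero : a • (x - z) + b • (y - z) = 0 := by
      rw [smul_sub, smul_sub, sub_add_sub_comm, ← add_smul, hab, one_smul, sub_self]
    simpa using congrArg (g z) hzero
  have hfx := mul_le_mul_of_nonneg_left (hsub z hz x hx) ha
  have hfy := mul_le_mul_of_nonneg_left (hsub z hz y hy) hb
  calc f z = (a + b) * f z := by rw [hab, one_mul]
    _ ≤ a • f x + b • f y := by simp only [smul_eq_mul]; linarith

lemma lipschitzOnWith_of_isSubgradientOn (hsub : ∀ x ∈ X, IsSubgradientOn X f x (g x))
    (hg : ∀ x ∈ X, ‖g x‖ ≤ L) : LipschitzOnWith L f X := by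
  refine LipschitzOnWith.of_le_add_mul L fun x hx y hy => ?_
  have hdual := (abs_le.1 ((g x).le_of_opNorm_le (hg x hx) (y - x))).1
  rw [← dist_eq_norm, dist_comm] at hdual
  linarith [hsub x hx y hy]

variable {S Ξ : Type*} [MetricSpace S] [TopologicalSpace.SeparableSpace S] [BoundedSpace S]
  [MeasurableSpace S] [BorelSpace S] [MeasurableSpace Ξ] {F : S → Ξ → ℝ} {μ : Measure Ξ}

lemma exists_lipschitz_excess (hF : ∀ x, Measurable (F x))
    (hLip : ∀ᵐ z ∂μ, LipschitzWith L fun x => F x z) (y : S) :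
    ∃ h : S × Ξ → ℝ, Measurable h ∧ (∀ x x' z, |h (x, z) - h (x', z)| ≤ L * dist x x') ∧
      (∀ p, |h p| ≤ L * Metric.diam (Set.univ : Set S)) ∧
      ∀ᵐ z ∂μ, ∀ x, h (x, z) = F x z - F y z := by
  classical
  -- Outside a measurable null set the loss is Lipschitz; on it the excess may be taken to be `0`.
  set N : Set Ξ := toMeasurable μ {z | ¬LipschitzWith L fun x => F x z}
  set h : S → Ξ → ℝ := fun x => Nᶜ.indicator (F x - F y)
  have hlip : ∀ x x' z, |h x z - h x' z| ≤ L * dist x x' := fun x x' z => by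
    by_cases hz : z ∈ N
    · simp only [h, Set.indicator_of_notMem (Set.notMem_compl_iff.2 hz), sub_self, abs_zero]
      positivity
    · have hLipz : LipschitzWith L fun x => F x z :=
        not_not.1 fun hbad => hz (subset_toMeasurable μ _ hbad)
      simpa [h, hz, Real.dist_eq] using hLipz.dist_le_mul x x'
  refine ⟨Function.uncurry h, ?_, hlip, fun ⟨x, z⟩ => ?_, ?_⟩
  · refine measurable_uncurry_of_continuous_of_measurable
      (fun z => (LipschitzWith.of_dist_le_mul fun x x' => hlip x x' z).continuous) fun x => ?_
    exact ((hF x).sub (hF y)).indicator (measurableSet_toMeasurable _ _).compl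
  · have hzero : h y z = 0 := by simp [h]
    calc |h x z| ≤ L * dist x y := by simpa [hzero] using hlip x y z
      _ ≤ L * Metric.diam (Set.univ : Set S) := by
        gcongr
        exact Metric.dist_le_diam_of_mem (Bornology.IsBounded.all _) (Set.mem_univ x)
          (Set.mem_univ y)
  · have hnull : μ N = 0 := by rw [measure_toMeasurable]; exact hLip
    filter_upwards [measure_eq_zero_iff_ae_notMem.1 hnull] with z hz x
    simp [h, hz]

end ExcessLoss

section Objective

variable {S Ξ : Type*} [PseudoMetricSpace S] [MeasurableSpace Ξ] {X : Set S} {ν : Measure Ξ}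
  {F : S → Ξ → ℝ}

lemma convexOn_objective {E : Type*} [AddCommMonoid E] [Module ℝ E] {X : Set E} {F : E → Ξ → ℝ}
    (hX : Convex ℝ X) (hF : ∀ᵐ z ∂ν, ConvexOn ℝ X fun x => F x z)
    (hint : ∀ x ∈ X, Integrable (F x) ν) : ConvexOn ℝ X (objective F ν) := by
  refine ⟨hX, fun x hx y hy a b ha hb hab => ?_⟩
  have hx_int : Integrable (fun z => a * F x z) ν := (hint x hx).const_mul a
  have hy_int : Integrable (fun z => b * F y z) ν := (hint y hy).const_mul b
  calc objective F ν (a • x + b • y)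
      ≤ ∫ z, (a * F x z + b * F y z) ∂ν :=
        integral_mono_ae (hint _ (hX hx hy ha hb hab)) (hx_int.add hy_int)
          (hF.mono fun z hz => hz.2 hx hy ha hb hab)
    _ = a • objective F ν x + b • objective F ν y := by
        rw [integral_add hx_int hy_int, integral_const_mul, integral_const_mul]
        rfl

lemma lipschitzOnWith_objective [IsProbabilityMeasure ν] {L : ℝ≥0}
    (hint : ∀ x ∈ X, Integrable (F x) ν)
    (hLip : ∀ᵐ z ∂ν, LipschitzOnWith L (fun x => F x z) X) :
    LipschitzOnWith L (objective F ν) X := by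
  refine LipschitzOnWith.of_dist_le_mul fun x hx y hy => ?_
  rw [dist_eq_norm, objective, objective, ← integral_sub (hint x hx) (hint y hy)]
  simpa using norm_integral_le_of_norm_le_const (μ := ν)
    (hLip.mono fun z hz => (dist_eq_norm (F x z) (F y z)).symm.trans_le (hz.dist_le_mul x hx y hy))

lemma abs_apply_le_of_lipschitzOnWith {f : S → ℝ} {L : ℝ≥0}
    (hf : LipschitzOnWith L f X) (hX : Bornology.IsBounded X) {x y : S} (hx : x ∈ X)
    (hy : y ∈ X) : |f x| ≤ |f y| + L * Metric.diam X := by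
  have hdist : |f x - f y| ≤ L * Metric.diam X := (hf.dist_le_mul x hx y hy).trans (by
    gcongr
    exact Metric.dist_le_diam_of_mem hX hx hy)
  linarith [abs_sub_abs_le_abs_sub (f x) (f y)]

end Objective

section ErgodicAverage

variable {E Ω : Type*} [NormedAddCommGroup E] [NormedSpace ℝ E] {X : Set E} {x : ℕ → Ω → E}
  {f : E → ℝ} {ω : Ω} {T : ℕ}

lemma average_eq_centerMass (x : ℕ → Ω → E) (T : ℕ) (ω : Ω) :
    average x T ω = (Finset.range T).centerMass (fun _ => (1 : ℝ)) fun n => x (n + 1) ω := by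
  simp only [average, Finset.centerMass, one_smul, Finset.sum_const, Finset.card_range,
    nsmul_eq_mul, mul_one, one_div]
  rw [Finset.range_eq_Ico, Finset.sum_Ico_add' (fun t => x t ω) 0 T 1]
  rfl

lemma average_mem (hX : Convex ℝ X) (hx : ∀ n, x (n + 1) ω ∈ X) (hT : 1 ≤ T) :
    average x T ω ∈ X := by
  rw [average_eq_centerMass]
  exact hX.centerMass_mem (fun _ _ => zero_le_one) (by simpa using Nat.lt_of_succ_le hT)
    fun n _ => hx n

lemma apply_average_sub_le (hf : ConvexOn ℝ X f) (hx : ∀ n, x (n + 1) ω ∈ X)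
    (hT : 1 ≤ T) (c : ℝ) :
    f (average x T ω) - c ≤ 𝔼 n ∈ Finset.range T, (f (x (n + 1) ω) - c) := by
  have hjensen := hf.map_centerMass_le (t := Finset.range T) (w := fun _ => (1 : ℝ))
    (p := fun n => x (n + 1) ω) (fun _ _ => zero_le_one) (by simpa using Nat.lt_of_succ_le hT)
    fun n _ => hx n
  rw [Finset.expect_sub_distrib, Finset.expect_const (Finset.nonempty_range_iff.2 (by lia)),
    average_eq_centerMass, Finset.expect_eq_sum_div_card, div_eq_inv_mul]
  simpa [Finset.centerMass] using hjensen

lemma tendsto_apply_average (hf : ConvexOn ℝ X f) {y : E} (hmin : IsMinOn f X y)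
    (hx : ∀ n, x (n + 1) ω ∈ X)
    (h : Tendsto (fun T => 𝔼 n ∈ Finset.range T, (f (x (n + 1) ω) - f y)) atTop (𝓝 0)) :
    Tendsto (fun T => f (average x T ω)) atTop (𝓝 (f y)) := by
  rw [← tendsto_sub_nhds_zero_iff]
  refine squeeze_zero' ?_ ?_ h
  · filter_upwards [eventually_ge_atTop 1] with T hT
    exact sub_nonneg.2 (hmin (average_mem hf.1 hx hT))
  · filter_upwards [eventually_ge_atTop 1] with T hT
    exact apply_average_sub_le hf hx hT (f y)

end ErgodicAverage

section Convergence

variable {E Ω Ξ : Type*} [NormedAddCommGroup E] [NormedSpace ℝ E] [SecondCountableTopology E]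
  [MeasurableSpace E] [BorelSpace E] [MeasurableSpace Ω] [MeasurableSpace Ξ]
  {P : Measure Ω} [IsProbabilityMeasure P] {X : Set E} {f : E → ℝ} {x : ℕ → Ω → E} {C : ℝ}

lemma measurable_apply_average (hX : Convex ℝ X) (hf : ContinuousOn f X)
    (hx : ∀ n ω, x (n + 1) ω ∈ X) (hmeas : ∀ n, Measurable (x (n + 1))) {T : ℕ} (hT : 1 ≤ T) :
    Measurable fun ω => f (average x T ω) := by
  have hfX : Continuous fun y : X => f y := hf.domRestrict
  have havg : Measurable fun ω => average x T ω := by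
    simp only [average_eq_centerMass, Finset.centerMass, one_smul]
    exact (Finset.measurable_fun_sum _ fun n _ => hmeas n).const_smul _
  exact hfX.measurable.comp
    (havg.subtype_mk (h := fun ω => average_mem hX (fun n => hx n ω) hT))

lemma integrable_and_tendsto_integral_of_ae_tendsto {Y : ℕ → Ω → ℝ} {c : ℝ}
    (hY : ∀ T, 1 ≤ T → Measurable (Y T)) (hC : ∀ T, 1 ≤ T → ∀ ω, |Y T ω| ≤ C)
    (h : ∀ᵐ ω ∂P, Tendsto (fun T => Y T ω) atTop (𝓝 c)) :
    (∀ T, 1 ≤ T → Integrable (Y T) P) ∧ Tendsto (fun T => ∫ ω, Y T ω ∂P) atTop (𝓝 c) := by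
  refine ⟨fun T hT => .of_bound (hY T hT).aestronglyMeasurable C (ae_of_all _ (hC T hT)), ?_⟩
  simpa using tendsto_integral_filter_of_dominated_convergence (fun _ => C)
    ((eventually_ge_atTop 1).mono fun T hT => (hY T hT).aestronglyMeasurable)
    ((eventually_ge_atTop 1).mono fun T hT => ae_of_all _ (hC T hT)) (integrable_const C) h

variable {ψ : E → ℝ} {m B : ℝ} {ν : Measure Ξ} [IsProbabilityMeasure ν] {F : E → Ξ → ℝ}
  {G : E → Ξ → StrongDual ℝ E} {ξ : ℕ → Ω → Ξ} {L : ℝ≥0} {α : ℕ → ℝ} {x₁ y : E}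

lemma IsEMD.ae_tendsto_expect_objective_sub (hx : IsEMD X ψ G ξ α x₁ x) (hx₁ : x₁ ∈ X)
    (hψ : DifferentiableOn ℝ ψ X) (hsc : StrongConvexOn X m ψ) (hm : 0 < m)
    (hB : ∀ x ∈ X, ∀ y ∈ X, bregman X ψ x y ≤ B) (hα : IsDiminishing fun n => α (n + 1))
    (hFmeas : ∀ x ∈ X, Measurable (F x)) (hFint : ∀ x ∈ X, Integrable (F x) ν)
    (hGmeas : ∀ v, Measurable fun p : X × Ξ => G p.1 p.2 v)
    (hGsub : ∀ z, ∀ x ∈ X, IsSubgradientOn X (fun y => F y z) x (G x z))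
    (hξ : ∀ t, 1 ≤ t → Measurable (ξ t)) (hmix : IsTVMixing P ξ ν)
    (hGν : ∀ᵐ z ∂ν, ∀ x ∈ X, ‖G x z‖ ≤ L)
    (hGξ : ∀ t, 1 ≤ t → ∀ᵐ z ∂(P.map (ξ t)), ∀ x ∈ X, ‖G x z‖ ≤ L)
    (hy : y ∈ X) (hmin : IsMinOn (objective F ν) X y) :
    ∀ᵐ ω ∂P, Tendsto (fun T => 𝔼 n ∈ Finset.range T,
      (objective F ν (x (n + 1) ω) - objective F ν y)) atTop (𝓝 0) := by
  have : BoundedSpace X := boundedSpace_val_set_iff.2 (isBounded_of_bregman_le hψ hsc hm hB)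
  have hLip : ∀ z, (∀ x ∈ X, ‖G x z‖ ≤ L) → LipschitzWith L fun x : X => F x z := fun z hz =>
    lipschitzOnWith_iff_restrict.1 (lipschitzOnWith_of_isSubgradientOn (hGsub z) hz)
  obtain ⟨h, hh, hhlip, hC, hhF⟩ := exists_lipschitz_excess
    (μ := ν + Measure.sum fun n => P.map (ξ (n + 1))) (F := fun x : X => F x)
    (fun x => hFmeas x x.2) (L := L) (by
      rw [ae_add_measure_iff, Measure.ae_sum_iff]
      exact ⟨hGν.mono hLip, fun n => (hGξ (n + 1) (by lia)).mono hLip⟩) ⟨y, hy⟩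
  rw [ae_add_measure_iff, Measure.ae_sum_iff] at hhF
  have hmean : ∀ w : X, ∫ z, h (w, z) ∂ν = objective F ν w - objective F ν y := fun w => by
    rw [objective, objective, ← integral_sub (hFint w w.2) (hFint y hy)]
    exact integral_congr_ae (hhF.1.mono fun z hz => hz w)
  have hsample : ∀ᵐ ω ∂P, ∀ n, (∀ x ∈ X, ‖G x (ξ (n + 1) ω)‖ ≤ L) ∧
      ∀ w : X, h (w, ξ (n + 1) ω) = F w (ξ (n + 1) ω) - F y (ξ (n + 1) ω) :=
    ae_all_iff.2 fun n => ae_of_ae_map (hξ (n + 1) (by lia)).aemeasurable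
      ((hGξ (n + 1) (by lia)).and (hhF.2 n))
  suffices hlim : ∀ᵐ ω ∂P, Tendsto (fun T => 𝔼 n ∈ Finset.range T,
      ∫ z, h (hx.iterate hx₁ n ω, z) ∂ν) atTop (𝓝 0) by
    simp only [hmean] at hlim
    exact hlim
  refine ae_tendsto_expect_integral_of_regret_le (W := hx.iterate hx₁) hξ hmix
    (hx.measurable_iterate hx₁ hψ hsc hm hα.pos hGmeas) ?_ hh hC hhlip
    (fun w => (sub_nonneg.2 (hmin w.2)).trans_eq (hmean w).symm)
    (hα.tendsto_regret_bound B (L ^ 2 / (2 * m))) ?_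
  · filter_upwards [hsample] with ω hω
    exact hx.tendsto_dist_iterate hx₁ hψ hsc hm hα fun n => (hω n).1
  · filter_upwards [hsample] with ω hω T
    simp only [(hω _).2]
    exact hx.expect_loss_sub_le hx₁ hψ hsc hm hB hα hGsub (fun n => (hω n).1) hy T

end Convergence

end ErgodicMD

theorem corollary8_general
    {E : Type*} [NormedAddCommGroup E] [NormedSpace ℝ E] [SecondCountableTopology E]
    [MeasurableSpace E] [BorelSpace E]
    {Ω Ξ : Type*} [MeasurableSpace Ω] [MeasurableSpace Ξ]
    (P : Measure Ω) [IsProbabilityMeasure P] (X : Set E)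
    (ψ : E → ℝ) (hψ : DifferentiableOn ℝ ψ X) (m : ℝ) (hm : 0 < m) (hsc : StrongConvexOn X m ψ)
    (B : ℝ) (hB : ∀ x ∈ X, ∀ y ∈ X, ErgodicMD.bregman X ψ x y ≤ B)
    (ν : Measure Ξ) [IsProbabilityMeasure ν]
    (F : E → Ξ → ℝ) (hFmeas : ∀ x ∈ X, Measurable (F x)) (hFint : ∀ x ∈ X, Integrable (F x) ν)
    (G : E → Ξ → StrongDual ℝ E) (hGmeas : ∀ v, Measurable fun p : X × Ξ => G p.1 p.2 v)
    (hGsub : ∀ z, ∀ x ∈ X, ErgodicMD.IsSubgradientOn X (fun y => F y z) x (G x z))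
    (ξ : ℕ → Ω → Ξ) (hξ : ∀ t, 1 ≤ t → Measurable (ξ t)) (hmix : ErgodicMD.IsTVMixing P ξ ν)
    (L : ℝ≥0) (hGν : ∀ᵐ z ∂ν, ∀ x ∈ X, ‖G x z‖ ≤ L)
    (hGξ : ∀ t, 1 ≤ t → ∀ᵐ z ∂(P.map (ξ t)), ∀ x ∈ X, ‖G x z‖ ≤ L)
    (α : ℕ → ℝ) (hα : ErgodicMD.IsDiminishing fun n => α (n + 1))
    (x₁ : E) (hx₁ : x₁ ∈ X) (x : ℕ → Ω → E) (hx : ErgodicMD.IsEMD X ψ G ξ α x₁ x)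
    (xstar : E) (hxstar : xstar ∈ X) (hmin : IsMinOn (ErgodicMD.objective F ν) X xstar) :
    (∀ T, 1 ≤ T →
      Integrable (fun ω => ErgodicMD.objective F ν (ErgodicMD.average x T ω)) P) ∧
    Tendsto (fun T => ∫ ω, ErgodicMD.objective F ν (ErgodicMD.average x T ω) ∂P) atTop
      (𝓝 (ErgodicMD.objective F ν xstar)) ∧
    ∀ᵐ ω ∂P, Tendsto (fun T => ErgodicMD.objective F ν (ErgodicMD.average x T ω)) atTop
      (𝓝 (ErgodicMD.objective F ν xstar)) := by
  have hconv : ConvexOn ℝ X (ErgodicMD.objective F ν) := ErgodicMD.convexOn_objective hsc.1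
    (ae_of_all _ fun z => ErgodicMD.convexOn_of_isSubgradientOn hsc.1 (hGsub z)) hFint
  have hLip : LipschitzOnWith L (ErgodicMD.objective F ν) X :=
    ErgodicMD.lipschitzOnWith_objective hFint
      (hGν.mono fun z => ErgodicMD.lipschitzOnWith_of_isSubgradientOn (hGsub z))
  have hmem : ∀ n ω, x (n + 1) ω ∈ X := hx.mem_succ hx₁
  have hmeas : ∀ n, Measurable (x (n + 1)) := fun n => measurable_subtype_coe.comp
    ((hx.measurable_iterate hx₁ hψ hsc hm hα.pos hGmeas n).mono
      (ErgodicMD.pastSigma_le hξ n) le_rfl)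
  have hlim : ∀ᵐ ω ∂P, Tendsto (fun T => ErgodicMD.objective F ν (ErgodicMD.average x T ω)) atTop
      (𝓝 (ErgodicMD.objective F ν xstar)) :=
    (hx.ae_tendsto_expect_objective_sub hx₁ hψ hsc hm hB hα hFmeas hFint hGmeas hGsub hξ hmix hGν
      hGξ hxstar hmin).mono fun ω =>
        ErgodicMD.tendsto_apply_average hconv hmin fun n => hmem n ω
  obtain ⟨hint, hexp⟩ := ErgodicMD.integrable_and_tendsto_integral_of_ae_tendsto
    (fun T => ErgodicMD.measurable_apply_average hsc.1 hLip.continuousOn hmem hmeas)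
    (fun T hT ω => ErgodicMD.abs_apply_le_of_lipschitzOnWith hLip
      (ErgodicMD.isBounded_of_bregman_le hψ hsc hm hB)
      (ErgodicMD.average_mem hsc.1 (fun n => hmem n ω) hT) hxstar) hlim
  exact ⟨hint, hexp, hlim⟩

theorem corollary8
    {E : Type*} [NormedAddCommGroup E] [NormedSpace ℝ E] [FiniteDimensional ℝ E]
    [MeasurableSpace E] [BorelSpace E]
    {Ω Ξ : Type*} [MeasurableSpace Ω] [MeasurableSpace Ξ]
    (P : Measure Ω) [IsProbabilityMeasure P]
    -- the compact convex domain and the prox-function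
    (X : Set E) (hXcompact : IsCompact X) (hXconvex : Convex ℝ X)
    (ψ : E → ℝ) (hψdiff : DifferentiableOn ℝ ψ X) (hψconvex : StrongConvexOn X 1 ψ)
    (R : ℝ) (hR : ∀ x ∈ X, ∀ y ∈ X, ErgodicMD.bregman X ψ x y ≤ (1 / 2) * R ^ 2)
    -- the convex functions, with the objective well defined, and the measurable subgradients
    (ν : Measure Ξ) [IsProbabilityMeasure ν]
    (F : E → Ξ → ℝ) (hFconvex : ∀ z, ConvexOn ℝ X (fun x => F x z))
    (hFmeas : ∀ x ∈ X, Measurable (F x)) (hFint : ∀ x ∈ X, Integrable (F x) ν)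
    (G : E → Ξ → StrongDual ℝ E) (hGmeas : Measurable (fun p : X × Ξ => G p.1 p.2))
    (hGsub : ∀ z, ∀ x ∈ X, ErgodicMD.IsSubgradientOn X (fun y => F y z) x (G x z))
    -- the samples, uniformly mixing
    (ξ : ℕ → Ω → Ξ) (hξmeas : ∀ t, 1 ≤ t → Measurable (ξ t))
    (hmix : ErgodicMD.UniformlyMixing P ξ ν)
    -- Lipschitz continuity, for almost every point under the limit law and under the laws of the samples
    (L : ℝ≥0)
    (hLipLimit : ∀ᵐ z ∂ν, LipschitzOnWith L (fun x => F x z) X ∧ ∀ x ∈ X, ‖G x z‖ ≤ L)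
    (hLipSample : ∀ t, 1 ≤ t → ∀ᵐ z ∂(P.map (ξ t)),
      LipschitzOnWith L (fun x => F x z) X ∧ ∀ x ∈ X, ‖G x z‖ ≤ L)
    -- the iterates with stepsizes `α / √t`
    (α : ℝ) (hα : 0 < α) (x₁ : E) (hx₁ : x₁ ∈ X) (x : ℕ → Ω → E)
    (hx : ErgodicMD.IsEMD X ψ G ξ (fun t => α / √(t : ℝ)) x₁ x)
    -- a minimizer of the objective
    (xstar : E) (hxstar : xstar ∈ X) (hmin : IsMinOn (ErgodicMD.objective F ν) X xstar) :
    (∀ T, 1 ≤ T →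
      Integrable (fun ω => ErgodicMD.objective F ν (ErgodicMD.average x T ω)) P) ∧
    Tendsto (fun T => ∫ ω, ErgodicMD.objective F ν (ErgodicMD.average x T ω) ∂P) atTop
      (𝓝 (ErgodicMD.objective F ν xstar)) ∧
    ∀ᵐ ω ∂P, Tendsto (fun T => ErgodicMD.objective F ν (ErgodicMD.average x T ω)) atTop
      (𝓝 (ErgodicMD.objective F ν xstar)) := by
  have := FiniteDimensional.proper_real E
  exact corollary8_general P X ψ hψdiff 1 one_pos hψconvex _ hR ν F hFmeas hFint G
    (fun v => hGmeas.apply_continuousLinearMap v) hGsub ξ hξmeas hmix.isTVMixing L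
    (hLipLimit.mono fun _ h => h.2) (fun t ht => (hLipSample t ht).mono fun _ h => h.2) _
    (ErgodicMD.isDiminishing_div_sqrt hα) x₁ hx₁ x hx xstar hxstar hmin
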